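/- **Setting.** Let $N\ge 0$, $J\in\mathbb R^{N\times N}$, $h\in\mathbb R^N$, $\beta>0$. For $X\in\{\pm1\}^N$ put $E(X)=\sum_{i,j}J_{ij}x_ix_j+\sum_i h_ix_i$, $Z=\sum_X e^{-\beta E(X)}$, $\mathcal F=-\frac1\beta\ln Z$, and for a probability distribution $Q$ on $\{\pm1\}^N$ let its variational free energy be $\mathbb E_Q\big[E(X)+\frac1\beta\ln Q(X)\big]$. Let $\|J\|_F=\big(\sum_{i,j}J_{ij}^2\big)^{1/2}$. * $\mathcal F^\star_{\rm naive}$ is the infimum of the variational free energy over all product distributions on $\{\pm1\}^N$. * Criticality order (for symmetric $J$): list the pairs $\{u,v\}$, $u\ne v$, by non-increasing $|J_{uv}|$ (ties broken arbitrarily) and build a maximum spanning tree greedily: a pair is added if and only if it closes no cycle, and whenever $\{u,v\}$ is added, those of $u,v$ that are not yet listed are appended to the list of spins (in arbitrary order if both are new). Any resulting list of all the spins is a criticality order (for $N=1$ it consists of the only spin). * $\mathcal F^\star_{\rm CoRMF}$ is the infimum of the variational free energy over the distributions $Q_\theta(X)=\prod_{t=1}^N Q_\theta(x_{\pi(t)}\mid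 x_{\pi(1)},\dots,x_{\pi(t-1)})$, where $\pi$ is a criticality order and the conditional probabilities are the softmax outputs of a recurrent neural network that reads the preceding spins in the order $\pi$. The network has at least one stacked layer, $d$ hidden units in each layer, zero initial hidden state, first input $0$, an activation function $\sigma:\mathbb R\to\mathbb R$, and a fully connected two-output layer; $\theta$ consists of all its weights and biases, which are the same at all positions $t$. **Theorem.** 1. Let $J$ be symmetric and $\beta>0$, let $\pi$ be any criticality order, $\sigma$ any non-constant function, and $d\ge N$, with any number of layers. Then $$\mathcal F^\star_{\rm CoRMF}-\mathcal F\ \le\ \mathcal F^\star_{\rm naive}-\mathcal F .$$ 2. For $\beta=1$, $$\mathcal F^\star_{\rm naive}-\mathcal F\ \le\ 42\,N^{2/3}\,\|J\|_F^{2/3}\,\ln^{1/3}\!\big(48N\|J\|_F+e\big).$$ 3. There is an absolute constant $C>0$ such that, for all $N,J,h$ and $\beta>0$ with $N\|\beta J\|_F\ge 2$, $$\mathcal F^\star_{\rm naive}-\mathcal F\ \le\ \frac1\beta\,C\,N^{2/3}\,\|\beta J\|_F^{2/3}\,\ln^{1/3}\!\big(N\|\beta J\|_F\big).$$ Consequently,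 for symmetric $J$, the bounds in 2 and 3 hold for $\mathcal F^\star_{\rm CoRMF}-\mathcal F$ as well. -/

import Mathlib

open scoped BigOperators Matrix

/-! ### Ising models and the variational free energy -/

/-- Spin configurations of `N` spins; `true` stands for spin `+1`, `false` for spin `-1`. -/
abbrev IsingConfig (N : ℕ) : Type := Fin N → Bool

/-- The numerical value `±1` of a spin. -/
def spinVal (b : Bool) : ℝ := if b then 1 else -1

/-- The energy `E(X) = ∑_{i,j} J_{ij} x_i x_j + ∑_i h_i x_i`. -/
noncomputable def isingEnergy {N : ℕ} (J : Matrix (Fin N) (Fin N) ℝ) (h : Fin N → ℝ)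
    (X : IsingConfig N) : ℝ :=
  ∑ i, ∑ j, J i j * spinVal (X i) * spinVal (X j) + ∑ i, h i * spinVal (X i)

/-- The partition function `Z = ∑_X exp (-β E(X))`. -/
noncomputable def isingPartition {N : ℕ} (β : ℝ) (J : Matrix (Fin N) (Fin N) ℝ)
    (h : Fin N → ℝ) : ℝ :=
  ∑ X : IsingConfig N, Real.exp (-β * isingEnergy J h X)

/-- The free energy `F = -(1/β) ln Z`. -/
noncomputable def isingFreeEnergy {N : ℕ} (β : ℝ) (J : Matrix (Fin N) (Fin N) ℝ)
    (h : Fin N → ℝ) : ℝ :=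
  -(1 / β) * Real.log (isingPartition β J h)

/-- The variational free energy `E_Q [E(X) + (1/β) ln Q(X)]` of a distribution on
configurations with mass function `Q` (with the convention `0 ln 0 = 0`). -/
noncomputable def variationalFreeEnergy {N : ℕ} (β : ℝ) (J : Matrix (Fin N) (Fin N) ℝ)
    (h : Fin N → ℝ) (Q : IsingConfig N → ℝ) : ℝ :=
  ∑ X, Q X * (isingEnergy J h X + (1 / β) * Real.log (Q X))

/-- The Frobenius norm. -/
noncomputable def frobNorm {N : ℕ} (J : Matrix (Fin N) (Fin N) ℝ) : ℝ :=
  Real.sqrt (∑ i, ∑ j, J i j ^ 2)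

/-! ### Naive mean field -/

/-- The product distribution under which spin `i` is `+1` with probability `p i`. -/
noncomputable def productDist {N : ℕ} (p : Fin N → Set.Icc (0 : ℝ) 1) (X : IsingConfig N) : ℝ :=
  ∏ i, if X i then (p i : ℝ) else 1 - (p i : ℝ)

/-- The optimal variational free energy of the naive mean-field ansatz. -/
noncomputable def naiveFreeEnergy {N : ℕ} (β : ℝ) (J : Matrix (Fin N) (Fin N) ℝ)
    (h : Fin N → ℝ) : ℝ :=
  ⨅ p : Fin N → Set.Icc (0 : ℝ) 1, variationalFreeEnergy β J h (productDist p)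

/-! ### Criticality order: greedy maximum spanning tree for the weights `|J u v|` -/

/-- `es` lists every edge `{u, v}`, `u ≠ v`, exactly once (in one of its two orientations), by
non-increasing weight `|J u v|`; ties and orientations are arbitrary. Pairs with `J u v = 0` are
kept as edges of weight zero: they come last, and matter only if the graph of nonzero
interactions is disconnected. -/
structure IsSortedEdgeList {N : ℕ} (J : Matrix (Fin N) (Fin N) ℝ) (es : List (Fin N × Fin N)) :
    Prop where
  ne : ∀ e ∈ es, e.1 ≠ e.2
  nodup : (es.map fun e => s(e.1, e.2)).Nodup
  complete : ∀ u v, u ≠ v → s(u, v) ∈ es.map fun e => s(e.1, e.2)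
  sorted : es.Pairwise fun e f => |J f.1 f.2| ≤ |J e.1 e.2|

open Classical in
/-- One step of the algorithm. The state is the forest built so far and the list of spins
ordered so far. The edge `(u, v)` is taken if it closes no cycle, that is, if `u` and `v` are in
different components; then those of `u`, `v` that are not yet listed are appended. -/
noncomputable def treeStep {N : ℕ} (s : SimpleGraph (Fin N) × List (Fin N)) (e : Fin N × Fin N) :
    SimpleGraph (Fin N) × List (Fin N) :=
  if s.1.Reachable e.1 e.2 then s
  else (s.1 ⊔ SimpleGraph.edge e.1 e.2, s.2 ++ [e.1, e.2].filter fun w => w ∉ s.2)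

/-- The list of spins produced by the algorithm from a sorted list of edges. -/
noncomputable def treeOrder {N : ℕ} (es : List (Fin N × Fin N)) : List (Fin N) :=
  (es.foldl treeStep (⊥, [])).2

open Classical in
/-- `π` (with `π t` the spin in position `t`) is a criticality order of the spins: a possible
output of the algorithm. Spins that are in no edge at all are put last (this concerns only the
spin of a one-spin model). -/
def IsCriticalityOrder {N : ℕ} (J : Matrix (Fin N) (Fin N) ℝ) (π : Equiv.Perm (Fin N)) : Prop :=
  ∃ es : List (Fin N × Fin N), IsSortedEdgeList J es ∧
    List.ofFn π = treeOrder es ++ (List.finRange N).filter fun w => w ∉ treeOrder es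

/-! ### The recurrent ansatz -/

/-- Parameters of a stacked recurrent network with layers `0, …, L`, `d` hidden units per layer
and scalar input, followed by a fully connected layer with two outputs. The same parameters are
used at every position of the sequence. -/
structure RNNParams (L d : ℕ) where
  /-- input weights of layer `0` -/
  inW : Fin d → ℝ
  /-- weights from layer `ℓ` to layer `ℓ + 1` -/
  up : Fin L → Matrix (Fin d) (Fin d) ℝ
  /-- recurrent (hidden-to-hidden) weights -/
  recW : Fin (L + 1) → Matrix (Fin d) (Fin d) ℝ
  /-- biases -/
  bias : Fin (L + 1) → Fin d → ℝ
  /-- weights of the output layer -/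
  outW : Bool → Fin d → ℝ
  /-- biases of the output layer -/
  outB : Bool → ℝ

namespace RNNParams

variable {L d : ℕ}

/-- One time step: from the input `x` and the hidden states `H` of all layers at the previous
time to the new hidden states. -/
noncomputable def step (σ : ℝ → ℝ) (θ : RNNParams L d) (x : ℝ) (H : Fin (L + 1) → Fin d → ℝ) :
    Fin (L + 1) → Fin d → ℝ :=
  fun k => Fin.induction (motive := fun _ => Fin d → ℝ)
    (fun a => σ (θ.inW a * x + (θ.recW 0 *ᵥ H 0) a + θ.bias 0 a))
    (fun ℓ below a =>
      σ ((θ.up ℓ *ᵥ below) a + (θ.recW ℓ.succ *ᵥ H ℓ.succ) a + θ.bias ℓ.succ a))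
    k

/-- The hidden states after the inputs `x 0, …, x (t - 1)`, started from zero. -/
noncomputable def state (σ : ℝ → ℝ) (θ : RNNParams L d) (x : ℕ → ℝ) :
    ℕ → Fin (L + 1) → Fin d → ℝ
  | 0 => 0
  | t + 1 => step σ θ (x t) (state σ θ x t)

/-- The softmax of the output layer, applied to the hidden state of the top layer. -/
noncomputable def output (θ : RNNParams L d) (H : Fin (L + 1) → Fin d → ℝ) (b : Bool) : ℝ :=
  Real.exp (θ.outW b ⬝ᵥ H (Fin.last L) + θ.outB b) /
    ∑ c : Bool, Real.exp (θ.outW c ⬝ᵥ H (Fin.last L) + θ.outB c)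

/-- The input at position `t`: the spin in position `t - 1` of the order `π`, and `0` at the
first position. -/
noncomputable def inputSeq {N : ℕ} (π : Equiv.Perm (Fin N)) (X : IsingConfig N) : ℕ → ℝ
  | 0 => 0
  | t + 1 => if ht : t < N then spinVal (X (π ⟨t, ht⟩)) else 0

/-- The distribution `Q_θ(X) = ∏_t Q_θ(x_{π t} | x_{π 0}, …, x_{π (t - 1)})` whose conditional
probabilities are the outputs of the network fed with the preceding spins in the order `π`. -/
noncomputable def dist {N : ℕ} (σ : ℝ → ℝ) (π : Equiv.Perm (Fin N)) (θ : RNNParams L d)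
    (X : IsingConfig N) : ℝ :=
  ∏ t : Fin N, θ.output (θ.state σ (inputSeq π X) (t + 1)) (X (π t))

end RNNParams

/-- The optimal variational free energy of the recurrent mean-field ansatz with activation
function `σ`, `L + 1` layers of `d` hidden units each, and spins in the order `π`; for a
criticality order `π` this is the CoRMF variational free energy. -/
noncomputable def recurrentFreeEnergy {N : ℕ} (β : ℝ) (J : Matrix (Fin N) (Fin N) ℝ)
    (h : Fin N → ℝ) (σ : ℝ → ℝ) (L d : ℕ) (π : Equiv.Perm (Fin N)) : ℝ :=
  ⨅ θ : RNNParams L d, variationalFreeEnergy β J h (RNNParams.dist σ π θ)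

/-! ### The two infima above are over sets that are bounded below -/

theorem variationalFreeEnergy_lower {N : ℕ} {β : ℝ} (hβ : 0 < β)
    (J : Matrix (Fin N) (Fin N) ℝ) (h : Fin N → ℝ) {Q : IsingConfig N → ℝ}
    (h0 : ∀ X, 0 ≤ Q X) (h1 : ∀ X, Q X ≤ 1) :
    ∑ X, (-|isingEnergy J h X| - 1 / β) ≤ variationalFreeEnergy β J h Q := by
  unfold variationalFreeEnergy
  refine Finset.sum_le_sum fun X _ => ?_
  have hE : -|isingEnergy J h X| ≤ Q X * isingEnergy J h X := by
    have ha := neg_abs_le (isingEnergy J h X)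
    have hb := abs_nonneg (isingEnergy J h X)
    nlinarith [h0 X, h1 X]
  have hL : -1 ≤ Q X * Real.log (Q X) := by
    rcases (h0 X).eq_or_lt with hq | hq
    · simp [← hq]
    · have hl := Real.one_sub_inv_le_log_of_pos hq
      have hm := mul_le_mul_of_nonneg_left hl hq.le
      have hi : Q X * (Q X)⁻¹ = 1 := mul_inv_cancel₀ hq.ne'
      nlinarith
  have hb : 0 < 1 / β := by positivity
  nlinarith [mul_le_mul_of_nonneg_left hL hb.le]

theorem bddBelow_naive {N : ℕ} {β : ℝ} (hβ : 0 < β)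
    (J : Matrix (Fin N) (Fin N) ℝ) (h : Fin N → ℝ) :
    BddBelow (Set.range fun p : Fin N → Set.Icc (0 : ℝ) 1 =>
      variationalFreeEnergy β J h (productDist p)) := by
  refine ⟨∑ X, (-|isingEnergy J h X| - 1 / β), ?_⟩
  rintro _ ⟨p, rfl⟩
  refine variationalFreeEnergy_lower hβ J h (fun X => ?_) (fun X => ?_)
  · refine Finset.prod_nonneg fun i _ => ?_
    have := (p i).2.1
    have := (p i).2.2
    split_ifs <;> linarith
  · refine Finset.prod_le_one (fun i _ => ?_) (fun i _ => ?_) <;>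
    · have := (p i).2.1
      have := (p i).2.2
      split_ifs <;> linarith

theorem bddBelow_recurrent {N : ℕ} {β : ℝ} (hβ : 0 < β)
    (J : Matrix (Fin N) (Fin N) ℝ) (h : Fin N → ℝ) (σ : ℝ → ℝ) (L d : ℕ)
    (π : Equiv.Perm (Fin N)) :
    BddBelow (Set.range fun θ : RNNParams L d =>
      variationalFreeEnergy β J h (RNNParams.dist σ π θ)) := by
  have hout : ∀ (θ : RNNParams L d) H b, 0 ≤ θ.output H b ∧ θ.output H b ≤ 1 := by
    intro θ H b
    refine ⟨by unfold RNNParams.output; positivity, ?_⟩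
    unfold RNNParams.output
    refine div_le_one_of_le₀ ?_ (by positivity)
    exact Finset.single_le_sum
      (f := fun c : Bool => Real.exp (θ.outW c ⬝ᵥ H (Fin.last L) + θ.outB c))
      (fun c _ => (Real.exp_pos _).le) (Finset.mem_univ b)
  refine ⟨∑ X, (-|isingEnergy J h X| - 1 / β), ?_⟩
  rintro _ ⟨θ, rfl⟩
  exact variationalFreeEnergy_lower hβ J h
    (fun X => Finset.prod_nonneg fun t _ => (hout θ _ _).1)
    (fun X => Finset.prod_le_one (fun t _ => (hout θ _ _).1) (fun t _ => (hout θ _ _).2))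

/-!
The recurrent ansatz contains every product distribution with nondegenerate marginals. With input
weights and inter-layer weights set to zero each layer evolves autonomously, and since `σ` takes
two different values a layer of `d ≥ N` units can serve as a unary clock
(`exists_counting_layer`), from which the output layer reads off any prescribed sequence of logits
(`exists_counting_readout`). By continuity of the variational free energy in the marginals the
recurrent optimum is at most the naive one (`recurrentFreeEnergy_le_naiveFreeEnergy`). This works
for every order of the spins.

The mean-field bound is proved by correlation rounding, in the form `2 (N ‖βJ‖)^(2/3) / β`,
without logarithmic factor (`naiveFreeEnergy_sub_le`). If the covariances `c` of a distribution `P`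
satisfy `‖J‖ (∑ c²)^(1/2) ≤ ε`, the product of the marginals of `P` has at least the entropy of `P`
and an energy larger by at most `ε` (`exists_variationalFreeEnergy_productDist_le`). Otherwise some
spin `k` has `∑_j c_jk² ≥ ε² / (N ‖J‖²)`, and conditioning on it costs at most `ln 2` of entropy
while the expected sum of the variances drops by at least that amount
(`sum_totalVariance_restrictSpin_le`). That sum is at most `N`, so that starting from the Gibbs
distribution the total loss is at most `ε + ln 2 · N² ‖J‖² / ε²` (`mass_mul_log_mass_sub_le`). The
conditional distributions are represented by restrictions of one unnormalised weight; all
quantities are made homogeneous of degree one, so that they are additive over the branches.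
-/

/-! ### Product distributions -/

theorem sum_prod_mul_prod {N : ℕ} (q f : Fin N → Bool → ℝ) :
    ∑ X : IsingConfig N, (∏ k, q k (X k)) * ∏ k, f k (X k) = ∏ k, ∑ b, q k b * f k b := by
  simp_rw [← Finset.prod_mul_distrib]
  exact (Fintype.prod_sum fun k b => q k b * f k b).symm

theorem sum_prod_mul_single {N : ℕ} {q : Fin N → Bool → ℝ} (hq : ∀ k, ∑ b, q k b = 1)
    (i : Fin N) (f : Bool → ℝ) :
    ∑ X : IsingConfig N, (∏ k, q k (X k)) * f (X i) = ∑ b, q i b * f b := by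
  have h := sum_prod_mul_prod q fun k b => if k = i then f b else 1
  rw [Finset.prod_eq_single i] at h
  · simpa using h
  · intro k _ hk
    simpa [hk] using hq k
  · simp

theorem sum_prod_mul_pair {N : ℕ} {q : Fin N → Bool → ℝ} (hq : ∀ k, ∑ b, q k b = 1)
    {i j : Fin N} (hij : i ≠ j) (f g : Bool → ℝ) :
    ∑ X : IsingConfig N, (∏ k, q k (X k)) * (f (X i) * g (X j)) =
      (∑ b, q i b * f b) * ∑ b, q j b * g b := by
  have h := sum_prod_mul_prod q fun k b => (if k = i then f b else 1) * if k = j then g b else 1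
  simp only [Finset.prod_mul_distrib,
    Finset.prod_ite_eq', Finset.mem_univ, if_true] at h
  rw [Finset.prod_eq_mul i j hij] at h
  · simpa [hij, hij.symm] using h
  · intro k _ hk
    simpa [hk.1, hk.2] using hq k
  · simp
  · simp

/-- The mass function of one spin which is `+1` with probability `x`. -/
def spinMass (x : ℝ) (b : Bool) : ℝ := if b then x else 1 - x

theorem productDist_eq_prod_spinMass {N : ℕ} (p : Fin N → Set.Icc (0 : ℝ) 1)
    (X : IsingConfig N) : productDist p X = ∏ i, spinMass (p i) (X i) := rfl

theorem sum_spinMass (x : ℝ) : ∑ b, spinMass x b = 1 := by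
  simp [spinMass]

theorem spinMass_nonneg (x : Set.Icc (0 : ℝ) 1) (b : Bool) : 0 ≤ spinMass x b := by
  have := x.2.1
  have := x.2.2
  unfold spinMass
  split_ifs <;> linarith

theorem sum_productDist {N : ℕ} (p : Fin N → Set.Icc (0 : ℝ) 1) :
    ∑ X, productDist p X = 1 := by
  have h := sum_prod_mul_prod (fun i => spinMass (p i)) fun _ _ => 1
  simp only [Finset.prod_const_one, mul_one, sum_spinMass] at h
  exact h

theorem spinVal_mul_self (b : Bool) : spinVal b * spinVal b = 1 := by
  cases b <;> simp [spinVal]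

/-! ### Moments of a weight on configurations -/

/-- Total mass of an unnormalised weight on configurations. -/
def mass {N : ℕ} (w : IsingConfig N → ℝ) : ℝ := ∑ X, w X

/-- Unnormalised first moment of spin `i`. -/
noncomputable def spinMoment {N : ℕ} (w : IsingConfig N → ℝ) (i : Fin N) : ℝ :=
  ∑ X, w X * spinVal (X i)

/-- Unnormalised mixed moment of spins `i` and `j`. -/
noncomputable def pairMoment {N : ℕ} (w : IsingConfig N → ℝ) (i j : Fin N) : ℝ :=
  ∑ X, w X * (spinVal (X i) * spinVal (X j))

/-- Covariance of spins `i` and `j` under the probability distribution proportional to `w`. -/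
noncomputable def spinCov {N : ℕ} (w : IsingConfig N → ℝ) (i j : Fin N) : ℝ :=
  pairMoment w i j / mass w - spinMoment w i * spinMoment w j / mass w ^ 2

/-- Sum of the variances of all spins under the distribution proportional to `w`, multiplied by
the total mass of `w`; it vanishes for `w = 0`. -/
noncomputable def totalVariance {N : ℕ} (w : IsingConfig N → ℝ) : ℝ :=
  ∑ j, (mass w - spinMoment w j ^ 2 / mass w)

theorem sum_mul_isingEnergy {N : ℕ} (J : Matrix (Fin N) (Fin N) ℝ) (h : Fin N → ℝ)
    (w : IsingConfig N → ℝ) :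
    ∑ X, w X * isingEnergy J h X =
      ∑ i, ∑ j, J i j * pairMoment w i j + ∑ i, h i * spinMoment w i := by
  simp only [isingEnergy, mul_add, Finset.sum_add_distrib, pairMoment, spinMoment,
    Finset.mul_sum]
  congr 1
  · rw [Finset.sum_comm]
    refine Finset.sum_congr rfl fun i _ => ?_
    rw [Finset.sum_comm]
    exact Finset.sum_congr rfl fun j _ => Finset.sum_congr rfl fun X _ => by ring
  · rw [Finset.sum_comm]
    exact Finset.sum_congr rfl fun i _ => Finset.sum_congr rfl fun X _ => by ring

/-- Probability that spin `i` is `+1` under the distribution with mass function `P`. -/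
noncomputable def upProb {N : ℕ} (P : IsingConfig N → ℝ) (i : Fin N) : ℝ :=
  ∑ X, if X i then P X else 0

theorem sum_mul_eq_sum_spinMass {N : ℕ} {P : IsingConfig N → ℝ} (h1 : mass P = 1)
    (i : Fin N) (f : Bool → ℝ) :
    ∑ X, P X * f (X i) = ∑ b, spinMass (upProb P i) b * f b := by
  have hdown : 1 - upProb P i = ∑ X, if X i then 0 else P X := by
    rw [← h1, mass, upProb, ← Finset.sum_sub_distrib]
    exact Finset.sum_congr rfl fun X _ => by split_ifs <;> simp
  simp only [spinMass, Fintype.sum_bool, if_true, Bool.false_eq_true, if_false]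
  rw [hdown, upProb, Finset.sum_mul, Finset.sum_mul, ← Finset.sum_add_distrib]
  refine Finset.sum_congr rfl fun X _ => ?_
  cases hX : X i <;> simp

theorem upProb_mem_Icc {N : ℕ} {P : IsingConfig N → ℝ} (h0 : ∀ X, 0 ≤ P X) (h1 : mass P = 1)
    (i : Fin N) : upProb P i ∈ Set.Icc (0 : ℝ) 1 := by
  refine ⟨Finset.sum_nonneg fun X _ => ?_, ?_⟩
  · split_ifs
    exacts [h0 X, le_rfl]
  · rw [← h1]
    refine Finset.sum_le_sum fun X _ => ?_
    split_ifs
    exacts [le_rfl, h0 X]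

theorem le_spinMass_upProb {N : ℕ} {P : IsingConfig N → ℝ} (h0 : ∀ X, 0 ≤ P X)
    (h1 : mass P = 1) (X : IsingConfig N) (i : Fin N) :
    P X ≤ spinMass (upProb P i) (X i) := by
  have h := sum_mul_eq_sum_spinMass h1 i fun b => if b = X i then 1 else 0
  have hs : ∑ b, spinMass (upProb P i) b * (if b = X i then 1 else 0) =
      spinMass (upProb P i) (X i) := by simp
  rw [← hs, ← h]
  have := Finset.single_le_sum (f := fun Y : IsingConfig N => P Y * if Y i = X i then 1 else 0)
    (fun Y _ => mul_nonneg (h0 Y) (by split_ifs <;> norm_num)) (Finset.mem_univ X)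
  simpa using this

/-! ### Independent rounding -/

/-- Gibbs' inequality: the relative entropy of `P` with respect to `Q` is nonnegative. -/
theorem sum_mul_log_le_sum_mul_log {ι : Type*} [Fintype ι] {P Q : ι → ℝ} (hP : ∀ x, 0 ≤ P x)
    (hQ : ∀ x, 0 ≤ Q x) (hPQ : ∀ x, 0 < P x → 0 < Q x) (hsum : ∑ x, Q x ≤ ∑ x, P x) :
    ∑ x, P x * Real.log (Q x) ≤ ∑ x, P x * Real.log (P x) := by
  have key : ∀ x, P x * Real.log (Q x) - P x * Real.log (P x) ≤ Q x - P x := by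
    intro x
    rcases (hP x).eq_or_lt with h | h
    · simp [← h, hQ x]
    · have hq := hPQ x h
      have hl := Real.log_le_sub_one_of_pos (div_pos hq h)
      rw [Real.log_div hq.ne' h.ne'] at hl
      calc _ = P x * (Real.log (Q x) - Real.log (P x)) := by ring
        _ ≤ P x * (Q x / P x - 1) := mul_le_mul_of_nonneg_left hl h.le
        _ = Q x - P x := by field_simp
  have := Finset.sum_le_sum fun x (_ : x ∈ Finset.univ) => key x
  simp only [Finset.sum_sub_distrib] at this
  linarith

/-- Among all distributions with given one-spin marginals the product distribution has the
largest entropy. -/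
theorem sum_productDist_mul_log_le {N : ℕ} {P : IsingConfig N → ℝ} (h0 : ∀ X, 0 ≤ P X)
    (h1 : mass P = 1) {p : Fin N → Set.Icc (0 : ℝ) 1} (hp : ∀ i, (p i : ℝ) = upProb P i) :
    ∑ X, productDist p X * Real.log (productDist p X) ≤ ∑ X, P X * Real.log (P X) := by
  have hQ0 : ∀ X, 0 ≤ productDist p X := fun X =>
    Finset.prod_nonneg fun i _ => spinMass_nonneg (p i) (X i)
  have hq : ∀ i, ∑ b, spinMass (p i) b = 1 := fun i => sum_spinMass _
  have hpos : ∀ X, 0 < P X → ∀ i, 0 < spinMass (p i) (X i) := fun X hX i => by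
    rw [hp]
    exact hX.trans_le (le_spinMass_upProb h0 h1 X i)
  -- Off the supports the factor in front of the logarithm vanishes, so that `log 0 = 0` is
  -- harmless.
  have hlogQ : ∀ X, productDist p X * Real.log (productDist p X) =
      ∑ i, productDist p X * Real.log (spinMass (p i) (X i)) := by
    intro X
    by_cases hX : productDist p X = 0
    · simp [hX]
    · rw [← Finset.mul_sum, productDist_eq_prod_spinMass, Real.log_prod]
      intro i _ hi
      exact hX (Finset.prod_eq_zero (Finset.mem_univ i) hi)
  have hlogP : ∀ X, P X * Real.log (productDist p X) =
      ∑ i, P X * Real.log (spinMass (p i) (X i)) := by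
    intro X
    rcases (h0 X).eq_or_lt with hX | hX
    · simp [← hX]
    · rw [← Finset.mul_sum, productDist_eq_prod_spinMass, Real.log_prod]
      exact fun i _ => (hpos X hX i).ne'
  calc ∑ X, productDist p X * Real.log (productDist p X)
      = ∑ i, ∑ b, spinMass (p i) b * Real.log (spinMass (p i) b) := by
        simp_rw [hlogQ]
        rw [Finset.sum_comm]
        refine Finset.sum_congr rfl fun i _ => ?_
        exact sum_prod_mul_single hq i fun b => Real.log (spinMass (p i) b)
    _ = ∑ X, P X * Real.log (productDist p X) := by
        simp_rw [hlogP]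
        rw [eq_comm, Finset.sum_comm]
        refine Finset.sum_congr rfl fun i _ => ?_
        rw [sum_mul_eq_sum_spinMass h1 i fun b => Real.log (spinMass (p i) b), ← hp]
    _ ≤ ∑ X, P X * Real.log (P X) := by
        refine sum_mul_log_le_sum_mul_log h0 hQ0
          (fun X hX => ?_) ?_
        · exact Finset.prod_pos fun i _ => hpos X hX i
        rw [sum_productDist, ← h1, mass]

/-- Replacing `P` by the product of its marginals raises the variational free energy by no more
than what the neglected covariances contribute to the energy. -/
theorem exists_variationalFreeEnergy_productDist_le {N : ℕ} (J : Matrix (Fin N) (Fin N) ℝ)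
    (h : Fin N → ℝ) {P : IsingConfig N → ℝ} (h0 : ∀ X, 0 ≤ P X) (h1 : mass P = 1) :
    ∃ p : Fin N → Set.Icc (0 : ℝ) 1, variationalFreeEnergy 1 J h (productDist p) ≤
      ∑ X, P X * (isingEnergy J h X + Real.log (P X)) +
        frobNorm J * √(∑ i, ∑ j, spinCov P i j ^ 2) := by
  refine ⟨fun i => ⟨upProb P i, upProb_mem_Icc h0 h1 i⟩, ?_⟩
  set p : Fin N → Set.Icc (0 : ℝ) 1 := fun i => ⟨upProb P i, upProb_mem_Icc h0 h1 i⟩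
  have hp : ∀ i, (p i : ℝ) = upProb P i := fun i => rfl
  have hq : ∀ i, ∑ b, spinMass (p i) b = 1 := fun i => sum_spinMass _
  have hmom : ∀ i, spinMoment (productDist p) i = spinMoment P i := fun i =>
    (sum_prod_mul_single hq i spinVal).trans (sum_mul_eq_sum_spinMass h1 i spinVal).symm
  have hpair : ∀ i j,
      (pairMoment (productDist p) i j - pairMoment P i j) ^ 2 ≤ spinCov P i j ^ 2 := by
    intro i j
    by_cases hij : i = j
    · subst hij
      have hP1 : ∑ X, P X = 1 := h1
      simp only [pairMoment, spinVal_mul_self, mul_one, sum_productDist, hP1, sub_self]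
      rw [zero_pow two_ne_zero]
      exact sq_nonneg _
    · have : pairMoment (productDist p) i j = spinMoment P i * spinMoment P j := by
        rw [← hmom, ← hmom]
        refine (sum_prod_mul_pair hq hij spinVal spinVal).trans ?_
        rw [← sum_prod_mul_single hq i, ← sum_prod_mul_single hq j]
        rfl
      rw [this, spinCov, h1]
      exact le_of_eq (by ring)
  have henergy : ∑ X, productDist p X * isingEnergy J h X - ∑ X, P X * isingEnergy J h X ≤
      frobNorm J * √(∑ i, ∑ j, spinCov P i j ^ 2) := by
    rw [sum_mul_isingEnergy, sum_mul_isingEnergy]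
    simp only [hmom, add_sub_add_right_eq_sub, ← Finset.sum_sub_distrib, ← mul_sub]
    have hcs := Real.sum_mul_le_sqrt_mul_sqrt Finset.univ (fun x : Fin N × Fin N => J x.1 x.2)
      fun x => pairMoment (productDist p) x.1 x.2 - pairMoment P x.1 x.2
    simp only [Fintype.sum_prod_type] at hcs
    refine hcs.trans (mul_le_mul_of_nonneg_left (Real.sqrt_le_sqrt ?_) (Real.sqrt_nonneg _))
    exact Finset.sum_le_sum fun i _ => Finset.sum_le_sum fun j _ => hpair i j
  have hent := sum_productDist_mul_log_le h0 h1 hp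
  simp only [variationalFreeEnergy, mul_add, Finset.sum_add_distrib, div_one, one_mul]
  linarith

/-! ### Conditioning on one spin -/

/-- The part of the weight `w` on which spin `k` equals `b`. -/
noncomputable def restrictSpin {N : ℕ} (w : IsingConfig N → ℝ) (k : Fin N) (b : Bool)
    (X : IsingConfig N) : ℝ :=
  if X k = b then w X else 0

section restrictSpin

variable {N : ℕ} (w : IsingConfig N → ℝ) (k : Fin N)

theorem restrictSpin_nonneg {w : IsingConfig N → ℝ} (hw : ∀ X, 0 ≤ w X) (b : Bool)
    (X : IsingConfig N) : 0 ≤ restrictSpin w k b X := by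
  unfold restrictSpin
  split_ifs
  exacts [hw X, le_rfl]

theorem restrictSpin_eq (b : Bool) (X : IsingConfig N) :
    restrictSpin w k b X = (w X + spinVal b * (w X * spinVal (X k))) / 2 := by
  unfold restrictSpin
  cases b <;> cases X k <;> simp [spinVal]

theorem mass_restrictSpin (b : Bool) :
    mass (restrictSpin w k b) = (mass w + spinVal b * spinMoment w k) / 2 := by
  simp only [mass, spinMoment, restrictSpin_eq, Finset.mul_sum, ← Finset.sum_add_distrib,
    Finset.sum_div]

theorem spinMoment_restrictSpin (b : Bool) (j : Fin N) :
    spinMoment (restrictSpin w k b) j =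
      (spinMoment w j + spinVal b * pairMoment w j k) / 2 := by
  simp only [spinMoment, pairMoment, restrictSpin_eq, Finset.mul_sum, ← Finset.sum_add_distrib,
    Finset.sum_div]
  exact Finset.sum_congr rfl fun X _ => by ring

end restrictSpin

theorem mass_nonneg {N : ℕ} {w : IsingConfig N → ℝ} (hw : ∀ X, 0 ≤ w X) : 0 ≤ mass w :=
  Finset.sum_nonneg fun X _ => hw X

theorem abs_spinMoment_le {N : ℕ} {w : IsingConfig N → ℝ} (hw : ∀ X, 0 ≤ w X) (j : Fin N) :
    |spinMoment w j| ≤ mass w := by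
  refine (Finset.abs_sum_le_sum_abs _ _).trans (Finset.sum_le_sum fun X _ => ?_)
  have : |spinVal (X j)| = 1 := by cases X j <;> simp [spinVal]
  rw [abs_mul, this, mul_one, abs_of_nonneg (hw X)]

theorem totalVariance_nonneg {N : ℕ} {w : IsingConfig N → ℝ} (hw : ∀ X, 0 ≤ w X) :
    0 ≤ totalVariance w := by
  refine Finset.sum_nonneg fun j _ => ?_
  have h := abs_spinMoment_le hw j
  have hsq : spinMoment w j ^ 2 ≤ mass w ^ 2 := sq_le_sq' (abs_le.1 h).1 (abs_le.1 h).2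
  rcases (mass_nonneg hw).eq_or_lt with h0 | h0
  · simp [← h0]
  · rw [sub_nonneg, div_le_iff₀ h0]
    nlinarith

theorem totalVariance_le {N : ℕ} {w : IsingConfig N → ℝ} (hw : ∀ X, 0 ≤ w X) :
    totalVariance w ≤ N * mass w := by
  have : totalVariance w ≤ ∑ _j : Fin N, mass w := Finset.sum_le_sum fun j _ =>
    sub_le_self _ (div_nonneg (sq_nonneg _) (mass_nonneg hw))
  simpa using this

/-- Conditioning on spin `k` lowers the expected variance of spin `j` by at least the square of
their covariance. -/
theorem sum_totalVariance_restrictSpin_le {N : ℕ} {w : IsingConfig N → ℝ} (k : Fin N)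
    (hb : ∀ b, 0 < mass (restrictSpin w k b)) :
    totalVariance (restrictSpin w k true) + totalVariance (restrictSpin w k false) ≤
      totalVariance w - mass w * ∑ j, spinCov w j k ^ 2 := by
  simp only [totalVariance, Finset.mul_sum, ← Finset.sum_add_distrib, ← Finset.sum_sub_distrib]
  refine Finset.sum_le_sum fun j _ => ?_
  have ht := hb true
  have hf := hb false
  simp only [spinMoment_restrictSpin, mass_restrictSpin, spinVal, if_true, Bool.false_eq_true,
    if_false, one_mul, neg_one_mul, spinCov, ← sub_eq_add_neg] at ht hf ⊢
  generalize mass w = W at *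
  generalize spinMoment w k = s at *
  generalize spinMoment w j = m at *
  generalize pairMoment w j k = c at *
  have hW : 0 < W := by linarith
  have hp : 0 < W + s := by linarith
  have hm : 0 < W - s := by linarith
  -- The decrease is `(W c - m s)² / (W (W² - s²))`, and `W² - s² ≤ W²`.
  have hid : (W + s) / 2 - ((m + c) / 2) ^ 2 / ((W + s) / 2) +
      ((W - s) / 2 - ((m - c) / 2) ^ 2 / ((W - s) / 2)) =
      W - m ^ 2 / W - (W * c - m * s) ^ 2 / (W * ((W + s) * (W - s))) := by
    field_simp
    ring
  have hcov : W * (c / W - m * s / W ^ 2) ^ 2 = (W * c - m * s) ^ 2 / (W * W ^ 2) := by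
    field_simp
  rw [hid, hcov]
  refine sub_le_sub_left ?_ _
  refine div_le_div_of_nonneg_left (sq_nonneg _) (by positivity) ?_
  exact mul_le_mul_of_nonneg_left (by nlinarith [sq_nonneg s]) hW.le

/-- A spin correlated with some spin is not deterministic. -/
theorem mass_restrictSpin_pos {N : ℕ} {w : IsingConfig N → ℝ} (hw : ∀ X, 0 ≤ w X)
    {j k : Fin N} (hc : spinCov w j k ≠ 0) (b : Bool) : 0 < mass (restrictSpin w k b) := by
  refine (mass_nonneg (restrictSpin_nonneg k hw b)).lt_of_ne fun h => hc ?_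
  have hzero : ∀ X, restrictSpin w k b X = 0 := fun X =>
    (Finset.sum_eq_zero_iff_of_nonneg fun Y _ => restrictSpin_nonneg k hw b Y).1 h.symm X
      (Finset.mem_univ X)
  have h1 := mass_restrictSpin w k b
  have h2 := spinMoment_restrictSpin w k b j
  rw [← h] at h1
  rw [spinMoment, Finset.sum_eq_zero fun X _ => by rw [hzero, zero_mul]] at h2
  have hs := spinVal_mul_self b
  have hW : mass w = -(spinVal b * spinMoment w k) := by linarith
  have hm : spinMoment w j = -(spinVal b * pairMoment w j k) := by linarith
  rw [spinCov, hm, hW]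
  by_cases h0 : spinMoment w k = 0
  · simp [h0]
  · have : spinVal b ≠ 0 := fun h => by simp [h] at hs
    field_simp
    ring

theorem card_support_restrictSpin_lt {N : ℕ} {w : IsingConfig N → ℝ} {k : Fin N} {b : Bool}
    (hb : 0 < mass (restrictSpin w k !b)) :
    (Finset.univ.filter fun X => restrictSpin w k b X ≠ 0).card <
      (Finset.univ.filter fun X => w X ≠ 0).card := by
  obtain ⟨X, -, hX⟩ := Finset.exists_ne_zero_of_sum_ne_zero hb.ne'
  have hXk : X k = !b := by
    by_contra hne
    exact hX (if_neg hne)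
  refine Finset.card_lt_card ((Finset.ssubset_iff_of_subset fun Y => ?_).2 ⟨X, ?_, ?_⟩)
  · simp only [Finset.mem_filter, Finset.mem_univ, true_and]
    exact fun hY h0 => hY (by simp [restrictSpin, h0])
  · simpa [restrictSpin, hXk] using hX
  · simp [restrictSpin, hXk]

/-- A binary choice has entropy at most `ln 2`. -/
theorem add_mul_log_add_le {a b : ℝ} (ha : 0 ≤ a) (hb : 0 ≤ b) :
    (a + b) * Real.log (a + b) ≤
      a * Real.log a + b * Real.log b + Real.log 2 * (a + b) := by
  rcases (add_nonneg ha hb).eq_or_lt with h | h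
  · have ha0 : a = 0 := by linarith
    have hb0 : b = 0 := by linarith
    simp [ha0, hb0]
  · have hc := Real.convexOn_mul_log.2 ha hb (by norm_num : (0 : ℝ) ≤ 1 / 2)
      (by norm_num : (0 : ℝ) ≤ 1 / 2) (by norm_num)
    simp only [smul_eq_mul, ← mul_add] at hc
    rw [Real.log_mul (by norm_num) h.ne', one_div, Real.log_inv] at hc
    linarith

/-- Correlation rounding. As long as the covariances are too large for independent rounding,
condition on a spin with large covariances. Each conditioning costs entropy at most
`ln 2` and lowers the total variance by at least `ε² / (N ‖J‖²)` times the mass. -/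
theorem mass_mul_log_mass_sub_le {N : ℕ} (J : Matrix (Fin N) (Fin N) ℝ) (h : Fin N → ℝ)
    {F ε K : ℝ} (hF : ∀ p, F ≤ variationalFreeEnergy 1 J h (productDist p)) (hε : 0 < ε)
    (hK0 : 0 ≤ K) (hK : N * frobNorm J ^ 2 ≤ K * ε ^ 2)
    (w : IsingConfig N → ℝ) (hw : ∀ X, 0 ≤ w X) :
    mass w * Real.log (mass w) - ∑ X, w X * (isingEnergy J h X + Real.log (w X)) ≤
      mass w * (ε - F) + Real.log 2 * K * totalVariance w := by
  induction hn : (Finset.univ.filter fun X => w X ≠ 0).card using Nat.strong_induction_on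
    generalizing w with
  | _ n ih =>
  have hl2 : 0 < Real.log 2 := Real.log_pos one_lt_two
  rcases (mass_nonneg hw).eq_or_lt with hW | hW
  · have hzero : ∀ X, w X = 0 := fun X =>
      (Finset.sum_eq_zero_iff_of_nonneg fun Y _ => hw Y).1 hW.symm X (Finset.mem_univ X)
    have := totalVariance_nonneg hw
    simp only [← hW, hzero, zero_mul, Finset.sum_const_zero, sub_zero, zero_add]
    positivity
  by_cases hsmall : frobNorm J * √(∑ i, ∑ j, spinCov w i j ^ 2) ≤ ε
  · set W := mass w with hWdef
    set P : IsingConfig N → ℝ := fun X => w X / W with hP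
    have hP0 : ∀ X, 0 ≤ P X := fun X => div_nonneg (hw X) hW.le
    have hP1 : mass P = 1 := by
      rw [mass, hP, ← Finset.sum_div]
      exact div_self hW.ne'
    have hcov : ∀ i j, spinCov P i j = spinCov w i j := by
      intro i j
      have h1 : ∀ i, spinMoment P i = spinMoment w i / W := fun i => by
        simp only [spinMoment, hP, Finset.sum_div, div_mul_eq_mul_div]
      have h2 : pairMoment P i j = pairMoment w i j / W := by
        simp only [pairMoment, hP, Finset.sum_div, div_mul_eq_mul_div]
      rw [spinCov, spinCov, hP1, h1, h1, h2, ← hWdef]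
      field_simp
    obtain ⟨p, hp⟩ := exists_variationalFreeEnergy_productDist_le J h hP0 hP1
    simp only [hcov] at hp
    have hsum : W * ∑ X, P X * (isingEnergy J h X + Real.log (P X)) =
        ∑ X, w X * (isingEnergy J h X + Real.log (w X)) - W * Real.log W := by
      rw [Finset.mul_sum, hWdef, mass, Finset.sum_mul, ← Finset.sum_sub_distrib]
      refine Finset.sum_congr rfl fun X _ => ?_
      rw [← mass, ← hWdef]
      rcases (hw X).eq_or_lt with hX | hX
      · simp [hP, ← hX]
      · simp only [hP]
        rw [Real.log_div hX.ne' hW.ne']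
        field_simp
        ring
    have hmul := mul_le_mul_of_nonneg_left ((hF p).trans (hp.trans (add_le_add_right hsmall _)))
      hW.le
    have hΦ := mul_nonneg (mul_nonneg hl2.le hK0) (totalVariance_nonneg hw)
    rw [mul_add, hsum] at hmul
    linarith
  · rw [not_le] at hsmall
    set S := ∑ i, ∑ j, spinCov w i j ^ 2 with hS
    have hS0 : 0 ≤ S := Finset.sum_nonneg fun i _ => Finset.sum_nonneg fun j _ => sq_nonneg _
    have hJS : ε ^ 2 < frobNorm J ^ 2 * S := by
      have := pow_lt_pow_left₀ hsmall hε.le two_ne_zero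
      rwa [mul_pow, Real.sq_sqrt hS0] at this
    obtain ⟨k, hk⟩ : ∃ k, 1 ≤ K * ∑ j, spinCov w j k ^ 2 := by
      by_contra! hlt
      have hsum : K * S ≤ N := by
        rw [hS, Finset.sum_comm, Finset.mul_sum]
        have := Finset.sum_le_sum fun k (_ : k ∈ Finset.univ) => (hlt k).le
        simpa using this
      have hN : (0 : ℝ) < N := by
        rcases N.eq_zero_or_pos with h0 | h0
        · subst h0
          simp [hS] at hJS
          nlinarith
        · exact_mod_cast h0
      have h1 := mul_le_mul_of_nonneg_right hK hS0
      have h2 := mul_le_mul_of_nonneg_right hsum (sq_nonneg ε)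
      nlinarith
    obtain ⟨j, hj⟩ : ∃ j, spinCov w j k ≠ 0 := by
      by_contra! h0
      simp only [h0] at hk
      norm_num at hk
    have hpos := mass_restrictSpin_pos hw hj
    have hdrop := sum_totalVariance_restrictSpin_le k hpos
    have hIH : ∀ b, _ := fun b => ih _ (hn ▸ card_support_restrictSpin_lt (hpos !b))
      (restrictSpin w k b) (restrictSpin_nonneg k hw b) rfl
    have hmass : mass (restrictSpin w k true) + mass (restrictSpin w k false) = mass w := by
      rw [mass_restrictSpin, mass_restrictSpin]
      simp only [spinVal, if_true, Bool.false_eq_true, if_false]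
      ring
    have hent := add_mul_log_add_le (hpos true).le (hpos false).le
    rw [hmass] at hent
    have hsplit : ∑ X, w X * (isingEnergy J h X + Real.log (w X)) =
        ∑ X, restrictSpin w k true X * (isingEnergy J h X + Real.log (restrictSpin w k true X)) +
        ∑ X, restrictSpin w k false X *
          (isingEnergy J h X + Real.log (restrictSpin w k false X)) := by
      rw [← Finset.sum_add_distrib]
      refine Finset.sum_congr rfl fun X _ => ?_
      cases hX : X k <;> simp [restrictSpin, hX]
    have hgain : Real.log 2 * mass w ≤
        Real.log 2 * K * (mass w * ∑ j, spinCov w j k ^ 2) := by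
      have := mul_le_mul_of_nonneg_left hk (mul_pos hl2 hW).le
      linarith
    have hdrop' := mul_le_mul_of_nonneg_left hdrop (mul_nonneg hl2.le hK0)
    have ht := hIH true
    have hf := hIH false
    rw [hsplit, ← hmass]
    rw [← hmass] at hent hgain hdrop'
    linarith

/-! ### The mean-field bound -/

theorem isingEnergy_smul {N : ℕ} (β : ℝ) (J : Matrix (Fin N) (Fin N) ℝ) (h : Fin N → ℝ)
    (X : IsingConfig N) : isingEnergy (β • J) (β • h) X = β * isingEnergy J h X := by
  simp [isingEnergy, mul_add, Finset.mul_sum, mul_assoc]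

theorem variationalFreeEnergy_smul {N : ℕ} {β : ℝ} (hβ : β ≠ 0) (J : Matrix (Fin N) (Fin N) ℝ)
    (h : Fin N → ℝ) (Q : IsingConfig N → ℝ) :
    variationalFreeEnergy 1 (β • J) (β • h) Q = β * variationalFreeEnergy β J h Q := by
  simp only [variationalFreeEnergy, isingEnergy_smul, Finset.mul_sum]
  refine Finset.sum_congr rfl fun X _ => ?_
  field_simp

theorem naiveFreeEnergy_sub_le_add {N : ℕ} {β : ℝ} (hβ : 0 < β)
    (J : Matrix (Fin N) (Fin N) ℝ) (h : Fin N → ℝ) {ε : ℝ} (hε : 0 < ε) :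
    naiveFreeEnergy β J h - isingFreeEnergy β J h ≤
      1 / β * (ε + Real.log 2 * ((N * frobNorm (β • J)) ^ 2 / ε ^ 2)) := by
  set w : IsingConfig N → ℝ := fun X => Real.exp (-isingEnergy (β • J) (β • h) X) with hw
  have hmass : mass w = isingPartition β J h := by
    simp only [mass, hw, isingPartition, isingEnergy_smul, neg_mul]
  have hZ : 0 < mass w := Finset.sum_pos (fun X _ => Real.exp_pos _) Finset.univ_nonempty
  have hF : ∀ p, β * naiveFreeEnergy β J h ≤
      variationalFreeEnergy 1 (β • J) (β • h) (productDist p) := by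
    intro p
    rw [variationalFreeEnergy_smul hβ.ne']
    exact mul_le_mul_of_nonneg_left (ciInf_le (bddBelow_naive hβ J h) p) hβ.le
  have hmain := mass_mul_log_mass_sub_le (β • J) (β • h) hF hε
    (K := N * frobNorm (β • J) ^ 2 / ε ^ 2) (by positivity) (by field_simp; rfl) w
    fun X => (Real.exp_pos _).le
  have hzero : ∑ X, w X * (isingEnergy (β • J) (β • h) X + Real.log (w X)) = 0 :=
    Finset.sum_eq_zero fun X _ => by simp [hw]
  have hΦ := mul_le_mul_of_nonneg_left (totalVariance_le (w := w) fun X => (Real.exp_pos _).le)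
    (show 0 ≤ Real.log 2 * (N * frobNorm (β • J) ^ 2 / ε ^ 2) by
      have := Real.log_pos one_lt_two
      positivity)
  have hlog : Real.log (mass w) ≤ ε - β * naiveFreeEnergy β J h +
      Real.log 2 * ((N * frobNorm (β • J)) ^ 2 / ε ^ 2) := by
    refine le_of_mul_le_mul_left ?_ hZ
    rw [hzero] at hmain
    have : Real.log 2 * (N * frobNorm (β • J) ^ 2 / ε ^ 2) * (N * mass w) =
        mass w * (Real.log 2 * ((N * frobNorm (β • J)) ^ 2 / ε ^ 2)) := by ring
    linarith
  rw [isingFreeEnergy, ← hmass, one_div, ← div_eq_inv_mul, le_div_iff₀ hβ]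
  have : β⁻¹ * β = 1 := inv_mul_cancel₀ hβ.ne'
  linear_combination hlog + Real.log (mass w) * this

/-- The mean-field bound without logarithmic factor. -/
theorem naiveFreeEnergy_sub_le {N : ℕ} {β : ℝ} (hβ : 0 < β)
    (J : Matrix (Fin N) (Fin N) ℝ) (h : Fin N → ℝ) :
    naiveFreeEnergy β J h - isingFreeEnergy β J h ≤
      1 / β * (2 * (N : ℝ) ^ (2 / 3 : ℝ) * frobNorm (β • J) ^ (2 / 3 : ℝ)) := by
  have hJ : 0 ≤ frobNorm (β • J) := Real.sqrt_nonneg _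
  rw [mul_assoc 2, ← Real.mul_rpow N.cast_nonneg hJ]
  set x := N * frobNorm (β • J) with hx
  have hx0 : 0 ≤ x := by positivity
  rcases hx0.eq_or_lt with h0 | h0
  · rw [← h0, Real.zero_rpow (by norm_num), mul_zero, mul_zero]
    refine le_of_forall_pos_le_add fun ε hε => ?_
    have := naiveFreeEnergy_sub_le_add hβ J h (mul_pos hβ hε)
    rw [← hx, ← h0] at this
    refine this.trans (le_of_eq ?_)
    field_simp
    ring
  · refine (naiveFreeEnergy_sub_le_add hβ J h (Real.rpow_pos_of_pos h0 (2 / 3))).trans ?_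
    refine mul_le_mul_of_nonneg_left ?_ (by positivity)
    -- `ε = x ^ (2 / 3)` balances the two terms `ε` and `x² / ε²`.
    have hbal : x ^ 2 / (x ^ (2 / 3 : ℝ)) ^ 2 = x ^ (2 / 3 : ℝ) := by
      rw [← Real.rpow_natCast, ← Real.rpow_natCast, ← Real.rpow_mul hx0, ← Real.rpow_sub h0]
      norm_num
    rw [← hx, hbal]
    have hl : Real.log 2 ≤ 1 := by linarith [Real.log_le_sub_one_of_pos (zero_lt_two (α := ℝ))]
    have := Real.rpow_pos_of_pos h0 (2 / 3)
    nlinarith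

/-! ### Recurrent networks realise product distributions -/

/-- A recurrent layer that receives no input can count: unit `k` takes the value `v` from time
`k + 1` on and the value `u` at the times `1, …, k`. Unit `0`, constantly `v ≠ 0` except in the
zero initial state, supplies the correction by which unit `k` tells the initial value `0` of unit
`k - 1` from `u`. -/
theorem exists_counting_layer {σ : ℝ → ℝ} (hσ : ∃ a b, σ a ≠ σ b) (d : ℕ) :
    ∃ (R : Matrix (Fin d) (Fin d) ℝ) (c : Fin d → ℝ) (u v : ℝ), u ≠ v ∧
      ∀ g : ℕ → Fin d → ℝ, g 0 = 0 → (∀ t a, g (t + 1) a = σ ((R *ᵥ g t) a + c a)) →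
        ∀ t (k : Fin d), g (t + 1) k = if (k : ℕ) ≤ t then v else u := by
  obtain ⟨a, b, hab, hb⟩ : ∃ a b, σ a ≠ σ b ∧ σ b ≠ 0 := by
    obtain ⟨a, b, hab⟩ := hσ
    by_cases hb : σ b = 0
    · exact ⟨b, a, hab.symm, fun ha => hab (ha.trans hb.symm)⟩
    · exact ⟨a, b, hab, hb⟩
  set r := (b - a) / (σ b - σ a) with hr
  set s := -(r * σ a / σ b) with hs
  refine ⟨Matrix.of fun i j => if (i : ℕ) = 0 then 0 else
      (if (j : ℕ) + 1 = i then r else 0) + if (j : ℕ) = 0 then s else 0,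
    fun i => if (i : ℕ) = 0 then b else a, σ a, σ b, hab, fun g hg0 hg t => ?_⟩
  have hba : σ b - σ a ≠ 0 := sub_ne_zero.2 hab.symm
  have hu : r * σ a + s * σ b + a = a := by
    rw [hs]
    field_simp
    ring
  have hv : r * σ b + s * σ b + a = b := by
    have : r * (σ b - σ a) = b - a := div_mul_cancel₀ _ hba
    linarith
  induction t with
  | zero =>
    intro k
    rw [hg, hg0, Matrix.mulVec_zero]
    by_cases hk : (k : ℕ) = 0 <;> simp [hk]
  | succ t ih =>
    intro k
    rw [hg]
    by_cases hk : (k : ℕ) = 0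
    · simp [Matrix.mulVec, dotProduct, hk]
    · have hd : 0 < d := k.pos
      have hR : ∀ f : Fin d → ℝ,
          ∑ j : Fin d, ((if (j : ℕ) + 1 = k then r else 0) + if (j : ℕ) = 0 then s else 0) * f j =
            r * f ⟨k - 1, by omega⟩ + s * f ⟨0, hd⟩ := by
        intro f
        simp only [add_mul, Finset.sum_add_distrib, ite_mul, zero_mul]
        congr 1
        · rw [Finset.sum_eq_single ⟨k - 1, by omega⟩]
          · rw [if_pos (by simp only; omega)]
          · intro j _ hj
            rw [if_neg]
            intro h
            exact hj (Fin.ext (by simp only; omega))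
          · simp
        · rw [Finset.sum_eq_single ⟨0, hd⟩]
          · simp
          · intro j _ hj
            rw [if_neg]
            intro h
            exact hj (Fin.ext h)
          · simp
      simp only [Matrix.mulVec, dotProduct, Matrix.of_apply, hk, if_false]
      rw [hR, ih, ih]
      simp only [zero_le, if_true]
      by_cases hkt : (k : ℕ) ≤ t + 1
      · rw [if_pos (by omega), if_pos hkt, hv]
      · rw [if_neg (by omega), if_neg hkt, hu]

/-- An affine readout of a counting layer with `d` units produces every prescribed sequence of
`d` values. -/
theorem exists_counting_readout {u v : ℝ} (huv : u ≠ v) (d : ℕ) (r : ℕ → ℝ) :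
    ∃ (w : Fin d → ℝ) (c : ℝ), ∀ t < d,
      (w ⬝ᵥ fun k : Fin d => if (k : ℕ) ≤ t then v else u) + c = r t := by
  have hvu : v - u ≠ 0 := sub_ne_zero.2 huv.symm
  set ω : ℕ → ℝ := fun k => ((if k = 0 then r 0 else r k - r (k - 1))) / (v - u) with hω
  refine ⟨fun k => ω k, -(∑ k : Fin d, ω k * u), fun t ht => ?_⟩
  have htel : ∀ t, ∑ k ∈ Finset.range (t + 1), ω k * (v - u) = r t := by
    intro t
    induction t with
    | zero => simp [hω, hvu]
    | succ t ih =>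
      rw [Finset.sum_range_succ, ih]
      simp [hω, hvu]
  rw [dotProduct, ← sub_eq_add_neg, ← Finset.sum_sub_distrib,
    Fin.sum_univ_eq_sum_range (fun k => ω k * (if k ≤ t then v else u) - ω k * u) d, ← htel t,
    ← Finset.sum_subset (Finset.range_subset_range.2 ht)]
  · refine Finset.sum_congr rfl fun k hk => ?_
    rw [if_pos (by simpa [Nat.lt_succ_iff] using hk)]
    ring
  · intro k _ hk
    rw [if_neg (by simpa [Nat.lt_succ_iff] using hk)]
    ring

/-- Every product distribution with nondegenerate marginals is the distribution of a network that
ignores its inputs. -/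
theorem exists_dist_eq_productDist {N d : ℕ} (L : ℕ) {σ : ℝ → ℝ} (hσ : ∃ a b, σ a ≠ σ b)
    (hd : N ≤ d) (π : Equiv.Perm (Fin N)) (p : Fin N → Set.Icc (0 : ℝ) 1)
    (h0 : ∀ i, (0 : ℝ) < p i) (h1 : ∀ i, (p i : ℝ) < 1) :
    ∃ θ : RNNParams L d, RNNParams.dist σ π θ = productDist p := by
  obtain ⟨R, c, u, v, huv, hR⟩ := exists_counting_layer hσ d
  obtain ⟨w, e, hw⟩ := exists_counting_readout huv d fun t =>
    if ht : t < N then Real.log (p (π ⟨t, ht⟩) / (1 - p (π ⟨t, ht⟩))) else 0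
  let θ : RNNParams L d :=
    { inW := 0
      up := 0
      recW := fun _ => R
      bias := fun _ => c
      outW := fun b => if b then w else 0
      outB := fun b => if b then e else 0 }
  refine ⟨θ, funext fun X => ?_⟩
  have hstep : ∀ (x : ℝ) (H : Fin (L + 1) → Fin d → ℝ) ℓ a,
      RNNParams.step σ θ x H ℓ a = σ ((R *ᵥ H ℓ) a + c a) := by
    intro x H ℓ a
    cases ℓ using Fin.cases with
    | zero => simp [RNNParams.step, θ]
    | succ ℓ => simp [RNNParams.step, θ]
  have hstate := hR (fun t => θ.state σ (RNNParams.inputSeq π X) t (Fin.last L)) rfl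
    fun t a => hstep _ _ _ a
  rw [RNNParams.dist, productDist,
    ← Equiv.prod_comp π fun i => if X i then (p i : ℝ) else 1 - p i]
  refine Finset.prod_congr rfl fun t _ => ?_
  have hp0 := h0 (π t)
  have hp1 : 0 < 1 - (p (π t) : ℝ) := by linarith [h1 (π t)]
  have hlogit : w ⬝ᵥ θ.state σ (RNNParams.inputSeq π X) (t + 1) (Fin.last L) + e =
      Real.log (p (π t) / (1 - p (π t))) := by
    have := hw t (t.2.trans_le hd)
    rw [dif_pos t.2] at this
    rw [← this]
    congr 2
    exact funext fun k => hstate t k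
  have hsum : (p (π t) : ℝ) / (1 - p (π t)) + 1 = 1 / (1 - p (π t)) := by
    field_simp
    ring
  have hout : ∀ H b, θ.output H b =
      (if b then Real.exp (w ⬝ᵥ H (Fin.last L) + e) else 1) /
        (Real.exp (w ⬝ᵥ H (Fin.last L) + e) + 1) := by
    intro H b
    cases b <;> simp [RNNParams.output, θ]
  rw [hout, hlogit, Real.exp_log (div_pos hp0 hp1), hsum]
  cases X (π t)
  · simp
  · simp only [if_true]
    field_simp

theorem continuous_variationalFreeEnergy_productDist {N : ℕ} (β : ℝ)
    (J : Matrix (Fin N) (Fin N) ℝ) (h : Fin N → ℝ) :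
    Continuous fun p : Fin N → Set.Icc (0 : ℝ) 1 =>
      variationalFreeEnergy β J h (productDist p) := by
  have hQ : ∀ X : IsingConfig N, Continuous fun p : Fin N → Set.Icc (0 : ℝ) 1 =>
      productDist p X := by
    intro X
    refine continuous_finsetProd _ fun i _ => ?_
    split_ifs <;> fun_prop
  refine continuous_finsetSum _ fun X _ => ?_
  have := ((hQ X).mul_const (isingEnergy J h X)).add
    ((Real.continuous_mul_log.comp (hQ X)).const_mul (1 / β))
  refine this.congr fun p => ?_
  simp only [Pi.add_apply, Function.comp]
  ring

theorem recurrentFreeEnergy_le_naiveFreeEnergy {N d : ℕ} {β : ℝ} (hβ : 0 < β)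
    (J : Matrix (Fin N) (Fin N) ℝ) (h : Fin N → ℝ) {σ : ℝ → ℝ} (hσ : ∃ a b, σ a ≠ σ b)
    (L : ℕ) (hd : N ≤ d) (π : Equiv.Perm (Fin N)) :
    recurrentFreeEnergy β J h σ L d π ≤ naiveFreeEnergy β J h := by
  have : Nonempty (Fin N → Set.Icc (0 : ℝ) 1) := ⟨fun _ => ⟨0, by simp⟩⟩
  refine le_ciInf fun p => ?_
  -- A softmax never outputs `0` or `1`, so `p` is approached from inside the cube.
  let P : ℝ → Fin N → Set.Icc (0 : ℝ) 1 := fun ε i =>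
    Set.projIcc 0 1 zero_le_one ((1 - ε) * p i + ε / 2)
  have hP0 : P 0 = p := by
    funext i
    simp [P]
  have hcont : Continuous fun ε => variationalFreeEnergy β J h (productDist (P ε)) := by
    refine (continuous_variationalFreeEnergy_productDist β J h).comp
      (continuous_pi fun i => continuous_projIcc.comp ?_)
    fun_prop
  have hlim := (hcont.tendsto 0).mono_left
    (nhdsWithin_le_nhds : nhdsWithin 0 (Set.Ioi (0 : ℝ)) ≤ _)
  rw [hP0] at hlim
  refine ge_of_tendsto hlim ?_
  filter_upwards [Ioo_mem_nhdsGT (zero_lt_one (α := ℝ))] with ε hε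
  have hval : ∀ i, (P ε i : ℝ) = (1 - ε) * p i + ε / 2 ∧
      0 < (1 - ε) * (p i : ℝ) + ε / 2 ∧ (1 - ε) * (p i : ℝ) + ε / 2 < 1 := by
    intro i
    have hl := mul_nonneg (sub_nonneg.2 hε.2.le) (p i).2.1
    have hr := mul_le_mul_of_nonneg_left (p i).2.2 (sub_nonneg.2 hε.2.le)
    have h0 : 0 < (1 - ε) * (p i : ℝ) + ε / 2 := by linarith [hε.1]
    have h1 : (1 - ε) * (p i : ℝ) + ε / 2 < 1 := by linarith [hε.1]
    refine ⟨?_, h0, h1⟩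
    simp only [P]
    rw [Set.projIcc_of_mem zero_le_one ⟨h0.le, h1.le⟩]
  obtain ⟨θ, hθ⟩ := exists_dist_eq_productDist L hσ hd π (P ε)
    (fun i => (hval i).1 ▸ (hval i).2.1) (fun i => (hval i).1 ▸ (hval i).2.2)
  rw [← hθ]
  exact ciInf_le (bddBelow_recurrent hβ J h σ L d π) θ

/-! ### The recurrent and the naive mean-field bounds -/

theorem mainTheorem1 :
    (∀ (N : ℕ) (J : Matrix (Fin N) (Fin N) ℝ) (h : Fin N → ℝ) (β : ℝ)
      (σ : ℝ → ℝ) (L d : ℕ) (π : Equiv.Perm (Fin N)),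
      J.IsSymm → 0 < β → (∃ a b, σ a ≠ σ b) → N ≤ d → IsCriticalityOrder J π →
        recurrentFreeEnergy β J h σ L d π - isingFreeEnergy β J h ≤
          naiveFreeEnergy β J h - isingFreeEnergy β J h) ∧
    (∀ (N : ℕ) (J : Matrix (Fin N) (Fin N) ℝ) (h : Fin N → ℝ),
      naiveFreeEnergy 1 J h - isingFreeEnergy 1 J h ≤
        42 * (N : ℝ) ^ (2 / 3 : ℝ) * frobNorm J ^ (2 / 3 : ℝ) *
          Real.log (48 * N * frobNorm J + Real.exp 1) ^ (1 / 3 : ℝ)) ∧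
    (∃ C : ℝ, 0 < C ∧
      ∀ (N : ℕ) (J : Matrix (Fin N) (Fin N) ℝ) (h : Fin N → ℝ) (β : ℝ),
        0 < β → 2 ≤ N * frobNorm (β • J) →
        naiveFreeEnergy β J h - isingFreeEnergy β J h ≤
          1 / β * (C * (N : ℝ) ^ (2 / 3 : ℝ) * frobNorm (β • J) ^ (2 / 3 : ℝ) *
            Real.log (N * frobNorm (β • J)) ^ (1 / 3 : ℝ))) := by
  refine ⟨fun N J h β σ L d π _ hβ hσ hd _ => ?_, fun N J h => ?_, 4, by norm_num,
    fun N J h β hβ hx => ?_⟩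
  · exact sub_le_sub_right (recurrentFreeEnergy_le_naiveFreeEnergy hβ J h hσ L hd π) _
  · have hJ : 0 ≤ frobNorm J := Real.sqrt_nonneg _
    have hgap := naiveFreeEnergy_sub_le one_pos J h
    rw [one_smul, div_one, one_mul] at hgap
    have hlog : 1 ≤ Real.log (48 * N * frobNorm J + Real.exp 1) := by
      rw [Real.le_log_iff_exp_le (by positivity)]
      have : 0 ≤ 48 * N * frobNorm J := by positivity
      linarith
    have hpow := Real.one_le_rpow hlog (by norm_num : (0 : ℝ) ≤ 1 / 3)
    have hy : 0 ≤ (N : ℝ) ^ (2 / 3 : ℝ) * frobNorm J ^ (2 / 3 : ℝ) := by positivity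
    nlinarith [mul_le_mul_of_nonneg_left hpow hy]
  · have hJ : 0 ≤ frobNorm (β • J) := Real.sqrt_nonneg _
    refine (naiveFreeEnergy_sub_le hβ J h).trans
      (mul_le_mul_of_nonneg_left ?_ (by positivity))
    have hlog : 1 / 2 ≤ Real.log (N * frobNorm (β • J)) := by
      have h1 := Real.log_le_log two_pos hx
      linarith [Real.log_two_gt_d9]
    have hpow : 1 / 2 ≤ Real.log (N * frobNorm (β • J)) ^ (1 / 3 : ℝ) := by
      refine le_trans ?_ (Real.rpow_le_rpow (by norm_num) hlog (by norm_num))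
      exact Real.self_le_rpow_of_le_one (by norm_num) (by norm_num) (by norm_num)
    have hy : 0 ≤ (N : ℝ) ^ (2 / 3 : ℝ) * frobNorm (β • J) ^ (2 / 3 : ℝ) := by positivity
    nlinarith [mul_le_mul_of_nonneg_left hpow hy]
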